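/- Let $K$ be a field, let $R=K[x]$, and for $n\in\mathbb N$ put $R_n=R/(x^n)$. Let $\mathcal T=D^b_0(\mathrm{fMod}\,R)$ be the full triangulated subcategory of the bounded derived category of finitely generated $R$-modules whose objects are the complexes with cohomology annihilated by some power of $x$; modules are regarded as complexes in degree $0$, and $\Sigma$ is the shift. For $i\ge 0$ and $i\ge n-m$, let $x^i\colon R_m\to R_n$ be the map induced by multiplication by $x^i$, and let $y\colon R_m\to\Sigma R_n$ be the morphism corresponding to the short exact sequence $0\to R_n\xrightarrow{x^m}R_{n+m}\xrightarrow{x^0}R_m\to0$, i.e. the third morphism of the associated distinguished triangle. An *octahedron* in $\mathcal T$ consists of objects $A,B,C,D,E,F$ and morphisms $f\colon A\to B$, $g\colon B\to C$, $h\colon A\to C$, $f'\colon B\to D$, $f''\colon D\to\Sigma A$, $h'\colon C\to E$, $h''\colon E\to\Sigma A$, $g'\colon C\to F$, $g''\colon F\to\Sigma B$, $k\colon D\to E$, $k'\colon E\to F$, $k''\colon F\to\Sigma D$, $l\colon B\to E$, $l'\colon E\to\Sigma B$ such that $$h=gf,\quad l=kf'=h'g,\quad f''=h''k,\quad g'=k'h',\quad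 l'=g''k'=\Sigma f\circ h'',\quad k''=\Sigma f'\circ g'',$$ and such that the triangles $(f,f',f'')$, $(h,h',h'')$, $(g,g',g'')$, $(k,k',k'')$ are distinguished. It is *good* if in addition the triangles $$B\xrightarrow{\,l\,}E\xrightarrow{\left(\begin{smallmatrix}k'\\-h''\end{smallmatrix}\right)}F\oplus\Sigma A\xrightarrow{(g''\ \ \Sigma f)}\Sigma B,\qquad B\xrightarrow{\left(\begin{smallmatrix}g\\f'\end{smallmatrix}\right)}C\oplus D\xrightarrow{(h'\ \ -k)}E\xrightarrow{\,l'\,}\Sigma B$$ are distinguished. Two octahedra are *isomorphic* if there are six isomorphisms between their corresponding objects which commute with all fourteen morphisms (using $\Sigma\phi_X$ on $\Sigma X$). Then the pair of composable morphisms $A=R_3\xrightarrow{f=x^1}B=R_3\xrightarrow{g=x^1}C=R_3$ can be extended to two non-isomorphic good octahedra in $\mathcal T$. Explicitly, set $D=F=\Sigma R_1\oplus R_1$, $E=\Sigma R_2\oplus R_2$, $$f'=\begin{pmatrix}y\\x^0\end{pmatrix},\qquad h'=\begin{pmatrix}y\\x^0\end{pmatrix},\qquad g''=\begin{pmatrix}-\Sigma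 x^2& y\end{pmatrix},\qquad h''=\begin{pmatrix}-\Sigma x^1& y\end{pmatrix}.$$ Together with $$k=\begin{pmatrix}\Sigma x^1&0\\0&x^1\end{pmatrix},\qquad k'=\begin{pmatrix}\Sigma x^0&0\\0&x^0\end{pmatrix},$$ and with the remaining morphisms determined by composition, these data form a good octahedron. So do the same data with $k,k'$ replaced by $$\tilde k=\begin{pmatrix}\Sigma x^1&y\\0&x^1\end{pmatrix},\qquad \tilde k'=\begin{pmatrix}\Sigma x^0&-y\\0&x^0\end{pmatrix}.$$ All the other morphisms of the two octahedra, including those determined by composition, coincide; and the two octahedra are not isomorphic. -/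

import Mathlib

open CategoryTheory CategoryTheory.Limits CategoryTheory.Pretriangulated Polynomial

universe w v u

noncomputable section

/-! ### Octahedra in a (pre)triangulated category -/

section Octahedra

variable (T : Type u) [Category.{v} T] [Preadditive T] [HasZeroObject T] [HasShift T ℤ]
  [∀ n : ℤ, (shiftFunctor T n).Additive] [Pretriangulated T]

/-- The six objects and the fourteen morphisms of a diagram having the shape of an octahedron. -/
structure OctahedralDiagram where
  (A B C D E F : T)
  f : A ⟶ B
  f' : B ⟶ D
  f'' : D ⟶ A⟦(1 : ℤ)⟧
  g : B ⟶ C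
  g' : C ⟶ F
  g'' : F ⟶ B⟦(1 : ℤ)⟧
  h : A ⟶ C
  h' : C ⟶ E
  h'' : E ⟶ A⟦(1 : ℤ)⟧
  k : D ⟶ E
  k' : E ⟶ F
  k'' : F ⟶ D⟦(1 : ℤ)⟧
  l : B ⟶ E
  l' : E ⟶ B⟦(1 : ℤ)⟧

variable {T}

namespace OctahedralDiagram

/-- The diagram is an octahedron: it commutes, and its four triangles are distinguished. -/
structure IsOctahedron (O : OctahedralDiagram T) : Prop where
  comm_h : O.f ≫ O.g = O.h
  comm_l₁ : O.f' ≫ O.k = O.l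
  comm_l₂ : O.g ≫ O.h' = O.l
  comm_f'' : O.k ≫ O.h'' = O.f''
  comm_g' : O.h' ≫ O.k' = O.g'
  comm_l'₁ : O.k' ≫ O.g'' = O.l'
  comm_l'₂ : O.h'' ≫ O.f⟦(1 : ℤ)⟧' = O.l'
  comm_k'' : O.g'' ≫ O.f'⟦(1 : ℤ)⟧' = O.k''
  dist_f : Triangle.mk O.f O.f' O.f'' ∈ distTriang T
  dist_h : Triangle.mk O.h O.h' O.h'' ∈ distTriang T
  dist_g : Triangle.mk O.g O.g' O.g'' ∈ distTriang T
  dist_k : Triangle.mk O.k O.k' O.k'' ∈ distTriang T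

/-- The diagram is a good octahedron: moreover the triangles
`B ⟶ E ⟶ F ⊞ A⟦1⟧ ⟶ B⟦1⟧` and `B ⟶ C ⊞ D ⟶ E ⟶ B⟦1⟧` are distinguished. -/
structure IsGoodOctahedron (O : OctahedralDiagram T) : Prop extends IsOctahedron O where
  dist_l : Triangle.mk O.l (biprod.lift O.k' (-O.h'')) (biprod.desc O.g'' (O.f⟦(1 : ℤ)⟧'))
    ∈ distTriang T
  dist_l' : Triangle.mk (biprod.lift O.g O.f') (biprod.desc O.h' (-O.k)) O.l' ∈ distTriang T

/-- An isomorphism of octahedra: six isomorphisms of objects, compatible with the fourteen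
morphisms. -/
structure Iso (O P : OctahedralDiagram T) where
  φA : O.A ≅ P.A
  φB : O.B ≅ P.B
  φC : O.C ≅ P.C
  φD : O.D ≅ P.D
  φE : O.E ≅ P.E
  φF : O.F ≅ P.F
  comm_f : φA.hom ≫ P.f = O.f ≫ φB.hom
  comm_f' : φB.hom ≫ P.f' = O.f' ≫ φD.hom
  comm_f'' : φD.hom ≫ P.f'' = O.f'' ≫ φA.hom⟦(1 : ℤ)⟧'
  comm_g : φB.hom ≫ P.g = O.g ≫ φC.hom
  comm_g' : φC.hom ≫ P.g' = O.g' ≫ φF.hom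
  comm_g'' : φF.hom ≫ P.g'' = O.g'' ≫ φB.hom⟦(1 : ℤ)⟧'
  comm_h : φA.hom ≫ P.h = O.h ≫ φC.hom
  comm_h' : φC.hom ≫ P.h' = O.h' ≫ φE.hom
  comm_h'' : φE.hom ≫ P.h'' = O.h'' ≫ φA.hom⟦(1 : ℤ)⟧'
  comm_k : φD.hom ≫ P.k = O.k ≫ φE.hom
  comm_k' : φE.hom ≫ P.k' = O.k' ≫ φF.hom
  comm_k'' : φF.hom ≫ P.k'' = O.k'' ≫ φD.hom⟦(1 : ℤ)⟧'
  comm_l : φB.hom ≫ P.l = O.l ≫ φE.hom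
  comm_l' : φE.hom ≫ P.l' = O.l' ≫ φB.hom⟦(1 : ℤ)⟧'

end OctahedralDiagram

/-- The morphism `X₁ ⊞ X₂ ⟶ Y₁ ⊞ Y₂` with matrix `(a b; c d)` acting on columns:
`a : X₁ ⟶ Y₁` and `b : X₂ ⟶ Y₁` form the first row, `c : X₁ ⟶ Y₂` and `d : X₂ ⟶ Y₂` the second. -/
def biprodMatrix {X₁ X₂ Y₁ Y₂ : T} (a : X₁ ⟶ Y₁) (b : X₂ ⟶ Y₁) (c : X₁ ⟶ Y₂) (d : X₂ ⟶ Y₂) :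
    X₁ ⊞ X₂ ⟶ Y₁ ⊞ Y₂ :=
  biprod.lift (biprod.desc a b) (biprod.desc c d)

end Octahedra

/-! ### The category `D^b_0(fMod K[x])` -/

section DerivedZero

variable (K : Type u) [Field K]

variable {K} in
lemma smul_eq_zero_of_mono {V W : FGModuleCat.{u} K[X]} (φ : V ⟶ W) [Mono φ] (r : K[X])
    (h : ∀ m : W, r • m = 0) (m : V) : r • m = 0 := by
  have : Mono ((forget₂ (FGModuleCat.{u} K[X]) (ModuleCat.{u} K[X])).map φ) := inferInstance
  have inj := (ModuleCat.mono_iff_injective _).1 this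
  apply inj
  erw [map_smul, h, map_zero]

variable {K} in
lemma exact_apply {S : ShortComplex (FGModuleCat.{u} K[X])} (hS : S.Exact) (m : S.X₂)
    (hm : S.g.hom.hom m = 0) : ∃ m₁ : S.X₁, S.f.hom.hom m₁ = m :=
  (ShortComplex.moduleCat_exact_iff _).1
    (hS.map (forget₂ (FGModuleCat.{u} K[X]) (ModuleCat.{u} K[X]))) m hm

variable {K} in
lemma mul_smul_eq_zero_of_exact {S : ShortComplex (FGModuleCat.{u} K[X])} (hS : S.Exact)
    (r s : K[X]) (h₁ : ∀ m : S.X₁, r • m = 0) (h₃ : ∀ m : S.X₃, s • m = 0) (m : S.X₂) :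
    (r * s) • m = 0 := by
  obtain ⟨m₁, hm₁⟩ := exact_apply hS (s • m) (by rw [map_smul, h₃])
  rw [mul_smul, ← hm₁, ← map_smul, h₁, map_zero]

section

variable [HasDerivedCategory.{w} (FGModuleCat.{u} K[X])]

/-- The objects of the derived category of finitely generated `K[x]`-modules whose cohomology is
annihilated by some power of `x`. -/
def cohomologyPowTorsion : ObjectProperty (DerivedCategory (FGModuleCat.{u} K[X])) := fun M =>
  ∃ N : ℕ, ∀ (i : ℤ) (m : (DerivedCategory.homologyFunctor (FGModuleCat.{u} K[X]) i).obj M),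
    (X ^ N : K[X]) • m = 0

instance : (cohomologyPowTorsion K).IsClosedUnderIsomorphisms where
  of_iso {M M'} e := by
    rintro ⟨N, hN⟩
    exact ⟨N, fun i m => smul_eq_zero_of_mono
      ((DerivedCategory.homologyFunctor _ i).map e.inv) _ (hN i) m⟩

instance : (cohomologyPowTorsion K).IsTriangulated where
  exists_zero := by
    refine ⟨_, isZero_zero _, 0, fun i m => ?_⟩
    have hz := (DerivedCategory.homologyFunctor (FGModuleCat.{u} K[X]) i).map_isZero
      (isZero_zero (DerivedCategory (FGModuleCat.{u} K[X])))
    have e := congrArg (fun φ => φ.hom.hom m) (hz.eq_of_src (𝟙 _) 0)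
    have e' : m = 0 := e
    rw [e', smul_zero]
  isStableUnderShiftBy a := ⟨by
    rintro M ⟨N, hN⟩
    refine ⟨N, fun i m => ?_⟩
    exact smul_eq_zero_of_mono
      (((DerivedCategory.homologyFunctor (FGModuleCat.{u} K[X]) 0).shiftIso
        a i (a + i) rfl).hom.app M) _ (hN _) m⟩
  toIsTriangulatedClosed₂ := .mk' (by
    rintro Tr hT ⟨N₁, h₁⟩ ⟨N₃, h₃⟩
    refine ⟨N₁ + N₃, fun i m => ?_⟩
    rw [pow_add]
    exact mul_smul_eq_zero_of_exact
      ((DerivedCategory.homologyFunctor (FGModuleCat.{u} K[X]) i).map_distinguished_exact Tr hT)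
      _ _ (h₁ i) (h₃ i) m)

/-- The objects of `D^b_0(fMod K[x])`, as a property of objects of the derived category. -/
def derivedBoundedZero : ObjectProperty (DerivedCategory (FGModuleCat.{u} K[X])) :=
  DerivedCategory.TStructure.t.bounded ⊓ cohomologyPowTorsion K

instance : (derivedBoundedZero K).IsTriangulated := by
  unfold derivedBoundedZero; infer_instance

/-- `D^b_0(fMod K[x])`: the full triangulated subcategory of the bounded derived category of
finitely generated `K[x]`-modules consisting of the complexes whose cohomology is annihilated
by some power of `x`. -/
abbrev Db0 := (derivedBoundedZero K).FullSubcategory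

end

/-- The module `R_n = K[x]/(x^n)`. -/
abbrev truncPoly (n : ℕ) : FGModuleCat.{u} K[X] :=
  FGModuleCat.of K[X] (K[X] ⧸ Ideal.span {(X ^ n : K[X])})

/-- The `K[x]`-linear map `R_m ⟶ R_n` induced by multiplication by `x^i`, where `n ≤ m + i`. -/
def mulPow (i m n : ℕ) (hi : n ≤ m + i) : truncPoly K m ⟶ truncPoly K n :=
  FGModuleCat.ofHom (Submodule.mapQ (Ideal.span {(X ^ m : K[X])}) (Ideal.span {(X ^ n : K[X])})
    (LinearMap.mulLeft K[X] (X ^ i : K[X])) (by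
      intro p hp
      rw [Ideal.mem_span_singleton] at hp
      rw [Submodule.mem_comap, Ideal.mem_span_singleton]
      exact ((pow_dvd_pow X hi).trans (by rw [pow_add])).trans
        ((mul_dvd_mul_right hp _).trans (by simp [mul_comm]))))

variable {K} in
lemma mulPow_apply (i m n : ℕ) (hi : n ≤ m + i) (p : K[X]) :
    (mulPow K i m n hi).hom.hom (Submodule.Quotient.mk p) = Submodule.Quotient.mk (X ^ i * p) :=
  rfl

/-- The sequence `R_n ⟶ R_{n+m} ⟶ R_m` given by `x^m` and `x^0`. -/
abbrev powSequence (m n : ℕ) : ShortComplex (FGModuleCat.{u} K[X]) :=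
  ShortComplex.mk (mulPow K m n (n + m) le_rfl) (mulPow K 0 (n + m) m (by omega)) (by
    refine FGModuleCat.hom_ext (LinearMap.ext fun q => ?_)
    obtain ⟨p, rfl⟩ := Submodule.Quotient.mk_surjective _ q
    refine (Submodule.Quotient.mk_eq_zero _).2 (Ideal.mem_span_singleton.2 ?_)
    simp)

lemma powSequence_shortExact (m n : ℕ) : (powSequence K m n).ShortExact where
  exact := by
    rw [← ShortComplex.exact_map_iff_of_faithful _
      (forget₂ (FGModuleCat.{u} K[X]) (ModuleCat.{u} K[X])), ShortComplex.moduleCat_exact_iff]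
    intro q hq
    obtain ⟨p, rfl⟩ := Submodule.Quotient.mk_surjective _ q
    have hq' := Ideal.mem_span_singleton.1 ((Submodule.Quotient.mk_eq_zero _).1 hq)
    obtain ⟨r, hr⟩ : (X ^ m : K[X]) ∣ p := by simpa using hq'
    exact ⟨Submodule.Quotient.mk r, by rw [hr]; rfl⟩
  mono_f := by
    refine (forget₂ (FGModuleCat.{u} K[X]) (ModuleCat.{u} K[X])).mono_of_mono_map
      ((ModuleCat.mono_iff_ker_eq_bot _).2 ?_)
    refine LinearMap.ker_eq_bot'.2 fun q hq => ?_
    obtain ⟨p, rfl⟩ := Submodule.Quotient.mk_surjective _ q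
    have hq' := Ideal.mem_span_singleton.1 ((Submodule.Quotient.mk_eq_zero _).1 hq)
    refine (Submodule.Quotient.mk_eq_zero _).2 (Ideal.mem_span_singleton.2 ?_)
    have hX : (X ^ m : K[X]) ≠ 0 := pow_ne_zero _ X_ne_zero
    refine (mul_dvd_mul_iff_left hX).1 ?_
    rw [← pow_add, add_comm]
    exact hq'
  epi_g := by
    refine (forget₂ (FGModuleCat.{u} K[X]) (ModuleCat.{u} K[X])).epi_of_epi_map
      ((ModuleCat.epi_iff_surjective _).2 fun q => ?_)
    obtain ⟨p, rfl⟩ := Submodule.Quotient.mk_surjective _ q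
    exact ⟨Submodule.Quotient.mk p, congrArg Submodule.Quotient.mk (by simp)⟩

section

variable [HasDerivedCategory.{w} (FGModuleCat.{u} K[X])]

lemma derivedBoundedZero_single (n : ℕ) : derivedBoundedZero K
    ((DerivedCategory.singleFunctor (FGModuleCat.{u} K[X]) 0).obj (truncPoly K n)) := by
  refine ⟨⟨⟨0, inferInstance⟩, ⟨0, inferInstance⟩⟩, n, fun i => ?_⟩
  by_cases hi : i = 0
  · subst hi
    let e : (DerivedCategory.homologyFunctor (FGModuleCat.{u} K[X]) 0).obj
        ((DerivedCategory.singleFunctor (FGModuleCat.{u} K[X]) 0).obj (truncPoly K n)) ≅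
          truncPoly K n :=
      (DerivedCategory.homologyFunctorFactors (FGModuleCat.{u} K[X]) 0).app _ ≪≫
        (HomologicalComplex.homologyFunctorSingleIso (FGModuleCat.{u} K[X])
          (ComplexShape.up ℤ) 0).app _
    refine smul_eq_zero_of_mono e.hom _ fun q => ?_
    obtain ⟨p, rfl⟩ := Submodule.Quotient.mk_surjective _ q
    exact (Submodule.Quotient.mk_eq_zero _).2 (Ideal.mem_span_singleton.2 (dvd_mul_right _ _))
  · have hz : IsZero ((DerivedCategory.homologyFunctor (FGModuleCat.{u} K[X]) i).obj
        ((DerivedCategory.singleFunctor (FGModuleCat.{u} K[X]) 0).obj (truncPoly K n))) := by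
      obtain hi | hi := lt_or_gt_of_ne hi
      · exact DerivedCategory.isZero_of_isGE _ 0 i hi
      · exact DerivedCategory.isZero_of_isLE _ 0 i hi
    intro m
    have e : m = 0 := congrArg (fun φ => φ.hom.hom m) (hz.eq_of_src (𝟙 _) 0)
    rw [e, smul_zero]

/-- The module `R_n`, placed in degree `0`, as an object of `D^b_0(fMod K[x])`. -/
abbrev truncObj (n : ℕ) : Db0 K := ⟨_, derivedBoundedZero_single K n⟩

/-- The morphism `x^i : R_m ⟶ R_n` of `D^b_0(fMod K[x])`, where `n ≤ m + i`. -/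
def xPow (i m n : ℕ) (hi : n ≤ m + i := by omega) : truncObj K m ⟶ truncObj K n :=
  ObjectProperty.homMk ((DerivedCategory.singleFunctor (FGModuleCat.{u} K[X]) 0).map
    (mulPow K i m n hi))

/-- The morphism `y : R_m ⟶ R_n⟦1⟧` of `D^b_0(fMod K[x])` which is the class of the extension
`0 ⟶ R_n ⟶ R_{n+m} ⟶ R_m ⟶ 0` given by `x^m` and `x^0`, that is, the third morphism of the
distinguished triangle attached to this short exact sequence. -/
def yExt (m n : ℕ) : truncObj K m ⟶ (truncObj K n)⟦(1 : ℤ)⟧ :=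
  ObjectProperty.homMk ((powSequence_shortExact K m n).singleδ ≫
    ((derivedBoundedZero K).ι.commShiftIso (1 : ℤ)).inv.app (truncObj K n))

/-- The octahedral diagram on `R_3 --x--> R_3 --x--> R_3` with given `k` and `k'`, and with
`f'`, `h'`, `g''`, `h''` as displayed; the other morphisms are the composites prescribed by the
shape of an octahedron. -/
abbrev octahedronWith
    (k : (truncObj K 1)⟦(1 : ℤ)⟧ ⊞ truncObj K 1 ⟶ (truncObj K 2)⟦(1 : ℤ)⟧ ⊞ truncObj K 2)
    (k' : (truncObj K 2)⟦(1 : ℤ)⟧ ⊞ truncObj K 2 ⟶ (truncObj K 1)⟦(1 : ℤ)⟧ ⊞ truncObj K 1) :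
    OctahedralDiagram (Db0 K) :=
  let f : truncObj K 3 ⟶ truncObj K 3 := xPow K 1 3 3
  let g : truncObj K 3 ⟶ truncObj K 3 := xPow K 1 3 3
  let f' : truncObj K 3 ⟶ (truncObj K 1)⟦(1 : ℤ)⟧ ⊞ truncObj K 1 :=
    biprod.lift (yExt K 3 1) (xPow K 0 3 1)
  let h' : truncObj K 3 ⟶ (truncObj K 2)⟦(1 : ℤ)⟧ ⊞ truncObj K 2 :=
    biprod.lift (yExt K 3 2) (xPow K 0 3 2)
  let g'' : (truncObj K 1)⟦(1 : ℤ)⟧ ⊞ truncObj K 1 ⟶ (truncObj K 3)⟦(1 : ℤ)⟧ :=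
    biprod.desc (-(xPow K 2 1 3)⟦(1 : ℤ)⟧') (yExt K 1 3)
  let h'' : (truncObj K 2)⟦(1 : ℤ)⟧ ⊞ truncObj K 2 ⟶ (truncObj K 3)⟦(1 : ℤ)⟧ :=
    biprod.desc (-(xPow K 1 2 3)⟦(1 : ℤ)⟧') (yExt K 2 3)
  { A := truncObj K 3
    B := truncObj K 3
    C := truncObj K 3
    D := (truncObj K 1)⟦(1 : ℤ)⟧ ⊞ truncObj K 1
    E := (truncObj K 2)⟦(1 : ℤ)⟧ ⊞ truncObj K 2
    F := (truncObj K 1)⟦(1 : ℤ)⟧ ⊞ truncObj K 1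
    f := f
    f' := f'
    f'' := k ≫ h''
    g := g
    g' := h' ≫ k'
    g'' := g''
    h := f ≫ g
    h' := h'
    h'' := h''
    k := k
    k' := k'
    k'' := g'' ≫ f'⟦(1 : ℤ)⟧'
    l := f' ≫ k
    l' := k' ≫ g'' }

/-- The first octahedron: `k` and `k'` are diagonal. -/
abbrev octahedron₁ : OctahedralDiagram (Db0 K) :=
  octahedronWith K
    (biprodMatrix ((xPow K 1 1 2)⟦(1 : ℤ)⟧') 0 0 (xPow K 1 1 2))
    (biprodMatrix ((xPow K 0 2 1)⟦(1 : ℤ)⟧') 0 0 (xPow K 0 2 1))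

/-- The second octahedron: `k` and `k'` have the off-diagonal entries `y` and `-y`. -/
abbrev octahedron₂ : OctahedralDiagram (Db0 K) :=
  octahedronWith K
    (biprodMatrix ((xPow K 1 1 2)⟦(1 : ℤ)⟧') (yExt K 1 2) 0 (xPow K 1 1 2))
    (biprodMatrix ((xPow K 0 2 1)⟦(1 : ℤ)⟧') (-yExt K 2 1) 0 (xPow K 0 2 1))

end

end DerivedZero

end

/-! A morphism `R_m ⟶ R_n` is multiplication by a polynomial, and composing such maps with `y` is
governed by naturality of extension classes (`yExt_naturality`). With `h'` and `h''` fixed, every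
`k` with `k ≫ h'' = f''` is upper triangular with diagonal `(x, x)` and corner `p • y`; every `k'`
with `h' ≫ k' = g'` has diagonal `(1, 1)` and corner `s • y` (`exists_eq_mulXMatrix`,
`exists_eq_reductionMatrix`). The vanishing of `k ≫ k'` forces `p + s` to be divisible by `x`.

The octahedral axiom gives distinguished triangles for some unknown corners. The shear of `E` by a
multiple of `y` moves a corner to any prescribed value, so the triangle on `k, k'` exists for every
`p` with corners `p` and `-p`. In the two triangles of a good octahedron, the effect of the shear on
`h'` and `h''` is absorbed by automorphisms of `C ⊞ D` and `F ⊞ A⟦1⟧`. Hence all `p` give good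
octahedra (`octahedronWith_isGoodOctahedron`); the theorem takes `p = 0` and `p = 1`.

These automorphisms of the biproducts mix summands, so they do not come from an isomorphism of
octahedra. For such an isomorphism from `p = 0` to `p = 1`, the components at `A, B, C` are
polynomials `a, b, c` congruent modulo `x^2`. The corners of the components at `D` and `E` are then
so restricted (`endomorphism_cone_components`) that they contribute nothing to the corner of the
square on `k`. What remains is `b • y = 0`, so `x ∣ b`, although `b` is invertible modulo `x^3`. -/

noncomputable section

/-! ### Multiplication maps between the modules `R_n`. -/

section Modules

variable (K : Type u) [Field K]

/-- The map `R_m ⟶ R_n` induced by multiplication by a polynomial `p` such that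
`x ^ n ∣ x ^ m * p`. -/
def mulPolyMod (p : K[X]) (m n : ℕ) (h : (X ^ n : K[X]) ∣ X ^ m * p) :
    truncPoly K m ⟶ truncPoly K n :=
  FGModuleCat.ofHom (Submodule.mapQ (Ideal.span {(X ^ m : K[X])}) (Ideal.span {(X ^ n : K[X])})
    (LinearMap.mulLeft K[X] p) (by
      intro q hq
      rw [Ideal.mem_span_singleton] at hq
      rw [Submodule.mem_comap, Ideal.mem_span_singleton, LinearMap.mulLeft_apply, mul_comm]
      exact h.trans (mul_dvd_mul_right hq _)))

variable {K}

lemma mulPolyMod_apply (p : K[X]) (m n : ℕ) (h : (X ^ n : K[X]) ∣ X ^ m * p) (q : K[X]) :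
    (mulPolyMod K p m n h).hom.hom (Submodule.Quotient.mk q) = Submodule.Quotient.mk (p * q) :=
  rfl

lemma truncPoly_hom_ext {m : ℕ} {M : FGModuleCat.{u} K[X]} {φ ψ : truncPoly K m ⟶ M}
    (h : ∀ q : K[X], φ.hom.hom (Submodule.Quotient.mk q) = ψ.hom.hom (Submodule.Quotient.mk q)) :
    φ = ψ := by
  refine FGModuleCat.hom_ext (LinearMap.ext fun q => ?_)
  obtain ⟨p, rfl⟩ := Submodule.Quotient.mk_surjective _ q
  exact h p

lemma mulPolyMod_comp (p q : K[X]) (l m n : ℕ) (h : (X ^ m : K[X]) ∣ X ^ l * p)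
    (h' : (X ^ n : K[X]) ∣ X ^ m * q) :
    mulPolyMod K p l m h ≫ mulPolyMod K q m n h' = mulPolyMod K (p * q) l n
      (h'.trans (by rw [← mul_assoc]; exact mul_dvd_mul_right h q)) :=
  truncPoly_hom_ext fun r => congrArg Submodule.Quotient.mk (show q * (p * r) = p * q * r by ring)

lemma mulPolyMod_congr {p q : K[X]} {m n : ℕ} (h : (X ^ n : K[X]) ∣ X ^ m * p)
    (h' : (X ^ n : K[X]) ∣ X ^ m * q) (hpq : (X ^ n : K[X]) ∣ p - q) :
    mulPolyMod K p m n h = mulPolyMod K q m n h' := by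
  refine truncPoly_hom_ext fun r => ?_
  rw [mulPolyMod_apply, mulPolyMod_apply]
  refine (Submodule.Quotient.eq _).2 (Ideal.mem_span_singleton.2 ?_)
  rw [← sub_mul]
  exact hpq.mul_right r

lemma mulPolyMod_zero (m n : ℕ) : mulPolyMod K 0 m n (by simp) = 0 :=
  truncPoly_hom_ext fun r => congrArg Submodule.Quotient.mk (show (0 : K[X]) * r = 0 by ring)

lemma mulPolyMod_neg (p : K[X]) (m n : ℕ) (h : (X ^ n : K[X]) ∣ X ^ m * p) :
    mulPolyMod K (-p) m n (by simpa using h) = - mulPolyMod K p m n h :=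
  truncPoly_hom_ext fun r => congrArg Submodule.Quotient.mk (show -p * r = -(p * r) by ring)

lemma mulPolyMod_add (p q : K[X]) (m n : ℕ) (h : (X ^ n : K[X]) ∣ X ^ m * p)
    (h' : (X ^ n : K[X]) ∣ X ^ m * q) :
    mulPolyMod K (p + q) m n (by rw [mul_add]; exact dvd_add h h') =
      mulPolyMod K p m n h + mulPolyMod K q m n h' :=
  truncPoly_hom_ext fun r => congrArg Submodule.Quotient.mk
    (show (p + q) * r = p * r + q * r by ring)

lemma mulPolyMod_one (m : ℕ) : mulPolyMod K 1 m m (by simp) = 𝟙 _ :=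
  truncPoly_hom_ext fun r => congrArg Submodule.Quotient.mk (show 1 * r = r by ring)

lemma dvd_of_mulPolyMod_eq {p q : K[X]} {m n : ℕ} (h : (X ^ n : K[X]) ∣ X ^ m * p)
    (h' : (X ^ n : K[X]) ∣ X ^ m * q) (e : mulPolyMod K p m n h = mulPolyMod K q m n h') :
    (X ^ n : K[X]) ∣ p - q := by
  have e₁ := congrArg (fun φ => φ.hom.hom (Submodule.Quotient.mk 1)) e
  dsimp only at e₁
  rw [mulPolyMod_apply, mulPolyMod_apply, mul_one, mul_one] at e₁
  exact Ideal.mem_span_singleton.1 ((Submodule.Quotient.eq _).1 e₁)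

lemma exists_eq_mulPolyMod {m n : ℕ} (φ : truncPoly K m ⟶ truncPoly K n) :
    ∃ (p : K[X]) (h : (X ^ n : K[X]) ∣ X ^ m * p), φ = mulPolyMod K p m n h := by
  obtain ⟨p, hp⟩ := Submodule.Quotient.mk_surjective _ (φ.hom.hom (Submodule.Quotient.mk 1))
  have key : ∀ q : K[X], φ.hom.hom (Submodule.Quotient.mk q) = Submodule.Quotient.mk (p * q) := by
    intro q
    have e : (Submodule.Quotient.mk q : K[X] ⧸ Ideal.span {(X ^ m : K[X])}) =
        q • Submodule.Quotient.mk 1 := by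
      rw [← Submodule.Quotient.mk_smul, smul_eq_mul, mul_one]
    rw [e, map_smul, ← hp, ← Submodule.Quotient.mk_smul, smul_eq_mul, mul_comm]
  have h : (X ^ n : K[X]) ∣ X ^ m * p := by
    have e : (Submodule.Quotient.mk (X ^ m) : K[X] ⧸ Ideal.span {(X ^ m : K[X])}) = 0 :=
      (Submodule.Quotient.mk_eq_zero _).2 (Ideal.mem_span_singleton_self _)
    have e₁ := key (X ^ m)
    rw [e, map_zero, eq_comm] at e₁
    rw [mul_comm]
    exact Ideal.mem_span_singleton.1 ((Submodule.Quotient.mk_eq_zero _).1 e₁)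
  exact ⟨p, h, truncPoly_hom_ext key⟩

lemma mulPow_eq_mulPolyMod (i m n : ℕ) (hi : n ≤ m + i) :
    mulPow K i m n hi = mulPolyMod K (X ^ i) m n (by rw [← pow_add]; exact pow_dvd_pow X hi) :=
  rfl

/-- The morphism from `0 ⟶ R_n ⟶ R_{n+m} ⟶ R_m ⟶ 0` to `0 ⟶ R_n' ⟶ R_{n'+m'} ⟶ R_m' ⟶ 0` given by
multiplication by polynomials `q`, `p`, `p`. -/
def powSequenceMap {m n m' n' : ℕ} (p q : K[X]) (hp : (X ^ m' : K[X]) ∣ X ^ m * p)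
    (hq : (X ^ n' : K[X]) ∣ X ^ n * q) (h : X ^ m' * q = X ^ m * p) :
    powSequence K m n ⟶ powSequence K m' n' where
  τ₁ := mulPolyMod K q n n' hq
  τ₂ := mulPolyMod K p (n + m) (n' + m') (by
    rw [pow_add, pow_add, mul_assoc, ← h, mul_left_comm, mul_comm]
    exact mul_dvd_mul_left _ hq)
  τ₃ := mulPolyMod K p m m' hp
  comm₁₂ := by
    dsimp only
    rw [mulPow_eq_mulPolyMod, mulPow_eq_mulPolyMod, mulPolyMod_comp, mulPolyMod_comp]
    exact mulPolyMod_congr _ _ (by rw [mul_comm q, h, sub_self]; exact dvd_zero _)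
  comm₂₃ := by
    dsimp only
    rw [mulPow_eq_mulPolyMod, mulPow_eq_mulPolyMod, mulPolyMod_comp, mulPolyMod_comp]
    exact mulPolyMod_congr _ _ (by rw [mul_comm p, sub_self]; exact dvd_zero _)

end Modules

/-! ### The maps `x^i` and the classes `y` in the derived category. -/

section Derived

variable (K : Type u) [Field K] [HasDerivedCategory.{w} (FGModuleCat.{u} K[X])]

/-- The morphism `R_m ⟶ R_n` of `D^b_0(fMod K[x])` induced by multiplication by a polynomial. -/
def mulPoly (p : K[X]) (m n : ℕ) (h : (X ^ n : K[X]) ∣ X ^ m * p) :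
    truncObj K m ⟶ truncObj K n :=
  ObjectProperty.homMk ((DerivedCategory.singleFunctor (FGModuleCat.{u} K[X]) 0).map
    (mulPolyMod K p m n h))

variable {K}

lemma mulPoly_comp (p q : K[X]) (l m n : ℕ) (h : (X ^ m : K[X]) ∣ X ^ l * p)
    (h' : (X ^ n : K[X]) ∣ X ^ m * q) :
    mulPoly K p l m h ≫ mulPoly K q m n h' = mulPoly K (p * q) l n
      (h'.trans (by rw [← mul_assoc]; exact mul_dvd_mul_right h q)) := by
  ext
  simp [mulPoly, ← Functor.map_comp, mulPolyMod_comp]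

lemma mulPoly_congr {p q : K[X]} {m n : ℕ} (h : (X ^ n : K[X]) ∣ X ^ m * p)
    (h' : (X ^ n : K[X]) ∣ X ^ m * q) (hpq : (X ^ n : K[X]) ∣ p - q) :
    mulPoly K p m n h = mulPoly K q m n h' := by
  rw [mulPoly, mulPolyMod_congr h h' hpq, mulPoly]

lemma mulPoly_eq_zero {p : K[X]} {m n : ℕ} (h : (X ^ n : K[X]) ∣ p) :
    mulPoly K p m n (h.mul_left _) = 0 := by
  ext
  rw [mulPoly, mulPolyMod_congr (q := 0) (h.mul_left _) (by simp) (by simpa using h),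
    mulPolyMod_zero, Functor.map_zero]
  rfl

lemma mulPoly_one (m : ℕ) : mulPoly K 1 m m (by simp) = 𝟙 _ := by
  ext
  simp [mulPoly, mulPolyMod_one]

lemma mulPoly_neg (p : K[X]) (m n : ℕ) (h : (X ^ n : K[X]) ∣ X ^ m * p) :
    mulPoly K (-p) m n (by simpa using h) = - mulPoly K p m n h := by
  ext
  rw [mulPoly, mulPolyMod_neg _ _ _ h, Functor.map_neg]
  rfl

lemma mulPoly_add (p q : K[X]) (m n : ℕ) (h : (X ^ n : K[X]) ∣ X ^ m * p)
    (h' : (X ^ n : K[X]) ∣ X ^ m * q) :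
    mulPoly K (p + q) m n (by rw [mul_add]; exact dvd_add h h') =
      mulPoly K p m n h + mulPoly K q m n h' := by
  ext
  rw [mulPoly, mulPolyMod_add _ _ _ _ h h', Functor.map_add]
  rfl

lemma dvd_of_mulPoly_eq {p q : K[X]} {m n : ℕ} {h : (X ^ n : K[X]) ∣ X ^ m * p}
    {h' : (X ^ n : K[X]) ∣ X ^ m * q} (e : mulPoly K p m n h = mulPoly K q m n h') :
    (X ^ n : K[X]) ∣ p - q :=
  dvd_of_mulPolyMod_eq h h' ((DerivedCategory.singleFunctor (FGModuleCat.{u} K[X]) 0).map_injective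
    (congrArg (fun φ => φ.hom) e))

lemma exists_eq_mulPoly {m n : ℕ} (φ : truncObj K m ⟶ truncObj K n) :
    ∃ (p : K[X]) (h : (X ^ n : K[X]) ∣ X ^ m * p), φ = mulPoly K p m n h := by
  obtain ⟨ψ, hψ⟩ := (DerivedCategory.singleFunctor (FGModuleCat.{u} K[X]) 0).map_surjective φ.hom
  obtain ⟨p, h, rfl⟩ := exists_eq_mulPolyMod ψ
  exact ⟨p, h, by ext; exact hψ.symm⟩

lemma xPow_eq_mulPoly (i m n : ℕ) (hi : n ≤ m + i) :
    xPow K i m n hi = mulPoly K (X ^ i) m n (by rw [← pow_add]; exact pow_dvd_pow X hi) :=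
  rfl

/-- Functoriality of the connecting morphism, applied to `powSequenceMap`. Every later rule for
composing with `y` comes from this one. -/
lemma yExt_naturality {m n m' n' : ℕ} (p q : K[X]) (hp : (X ^ m' : K[X]) ∣ X ^ m * p)
    (hq : (X ^ n' : K[X]) ∣ X ^ n * q) (h : X ^ m' * q = X ^ m * p) :
    yExt K m n ≫ (mulPoly K q n n' hq)⟦(1 : ℤ)⟧' = mulPoly K p m m' hp ≫ yExt K m' n' := by
  ext
  have e := (ShortComplex.ShortExact.singleTriangle.map (powSequence_shortExact K m n)
    (powSequence_shortExact K m' n') (powSequenceMap p q hp hq h)).comm₃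
  have e' := ((derivedBoundedZero K).ι.commShiftIso (1 : ℤ)).inv.naturality (mulPoly K q n n' hq)
  dsimp [yExt, mulPoly] at e e' ⊢
  replace e : (powSequence_shortExact K m n).singleδ ≫
      ((DerivedCategory.singleFunctor (FGModuleCat.{u} K[X]) 0).map
        (mulPolyMod K q n n' hq))⟦(1 : ℤ)⟧' =
      (DerivedCategory.singleFunctor (FGModuleCat.{u} K[X]) 0).map (mulPolyMod K p m m' hp) ≫
        (powSequence_shortExact K m' n').singleδ := e
  rw [Category.assoc, ← e', reassoc_of% e]

/-- Distinguished triangles of the full subcategory are detected by the inclusion, and the shift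
comparison built into `yExt` cancels. A separate `N` allows numerals in place of `n + m`. -/
lemma powTriangle_distinguished (m n N : ℕ) (hN : N = n + m) :
    Triangle.mk (xPow K m n N (by omega)) (xPow K 0 N m (by omega)) (yExt K m n) ∈
      distTriang (Db0 K) := by
  subst hN
  rw [← (derivedBoundedZero K).ι.map_distinguished_iff]
  refine isomorphic_distinguished _
    (powSequence_shortExact K m n).singleTriangle_distinguished _ ?_
  refine Triangle.isoMk _ _ (Iso.refl _) (Iso.refl _) (Iso.refl _)
    ((Category.comp_id _).trans (Category.id_comp _).symm)
    ((Category.comp_id _).trans (Category.id_comp _).symm) ?_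
  refine Eq.trans ?_ (Category.id_comp _).symm
  refine (congrArg (_ ≫ ·) (CategoryTheory.Functor.map_id _ _)).trans ?_
  refine (Category.comp_id _).trans ?_
  exact (Category.assoc _ _ _).trans
    ((congrArg ((powSequence_shortExact K m n).singleδ ≫ ·)
      (Iso.inv_hom_id_app ((derivedBoundedZero K).ι.commShiftIso (1 : ℤ)) (truncObj K n))).trans
    (Category.comp_id _))

/-- The t-structure leaves no nonzero morphism from degrees at most `-1` to degrees at least `0`.
This makes the matrices below upper triangular. -/
lemma eq_zero_of_shift_to_truncObj {m n : ℕ} (φ : (truncObj K m)⟦(1 : ℤ)⟧ ⟶ truncObj K n) :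
    φ = 0 := by
  ext
  have : DerivedCategory.TStructure.t.IsLE ((truncObj K m)⟦(1 : ℤ)⟧).obj (-1) := by
    have h : DerivedCategory.TStructure.t.IsLE (truncObj K m).obj 0 := by
      dsimp; infer_instance
    have : DerivedCategory.TStructure.t.IsLE
        (((derivedBoundedZero K).ι ⋙ shiftFunctor _ (1 : ℤ)).obj (truncObj K m)) (-1) :=
      DerivedCategory.TStructure.t.isLE_shift (truncObj K m).obj 0 1 (-1) (by simp)
    exact DerivedCategory.TStructure.t.isLE_of_iso
      (((derivedBoundedZero K).ι.commShiftIso (1 : ℤ)).symm.app (truncObj K m)) _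
  have : DerivedCategory.TStructure.t.IsGE (truncObj K n).obj 0 := by
    dsimp; infer_instance
  exact DerivedCategory.TStructure.t.zero φ.hom (-1) 0

end Derived

/-! ### Homotopy cartesian squares in a triangulated category. -/

section Abstract

variable {T : Type u} [Category.{v} T] [Preadditive T] [HasZeroObject T] [HasShift T ℤ]
  [∀ n : ℤ, (shiftFunctor T n).Additive] [Pretriangulated T]

lemma distinguished_of_isos {X Y Z X' Y' Z' : T} {f : X ⟶ Y} {g : Y ⟶ Z} {h : Z ⟶ X⟦(1 : ℤ)⟧}
    {f' : X' ⟶ Y'} {g' : Y' ⟶ Z'} {h' : Z' ⟶ X'⟦(1 : ℤ)⟧}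
    (H : Triangle.mk f g h ∈ distTriang T) (a : X ≅ X') (b : Y ≅ Y') (c : Z ≅ Z')
    (h₁ : f ≫ b.hom = a.hom ≫ f') (h₂ : g ≫ c.hom = b.hom ≫ g')
    (h₃ : h ≫ a.hom⟦(1 : ℤ)⟧' = c.hom ≫ h') : Triangle.mk f' g' h' ∈ distTriang T :=
  isomorphic_distinguished _ H _ (Triangle.isoMk _ _ a b c h₁ h₂ h₃).symm

lemma distinguished_of_iso₃ {X Y Z Z' : T} {f : X ⟶ Y} {g : Y ⟶ Z} {h : Z ⟶ X⟦(1 : ℤ)⟧}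
    (H : Triangle.mk f g h ∈ distTriang T) (e : Z ≅ Z') {g' : Y ⟶ Z'} {h' : Z' ⟶ X⟦(1 : ℤ)⟧}
    (hg : g ≫ e.hom = g') (hh : e.hom ≫ h' = h) : Triangle.mk f g' h' ∈ distTriang T :=
  distinguished_of_isos H (Iso.refl _) (Iso.refl _) e (by simp) (by simp [hg]) (by simp [hh])

lemma distinguished_of_iso₂ {X Y Y' Z : T} {f : X ⟶ Y} {g : Y ⟶ Z} {h : Z ⟶ X⟦(1 : ℤ)⟧}
    (H : Triangle.mk f g h ∈ distTriang T) (e : Y ≅ Y') {f' : X ⟶ Y'} {g' : Y' ⟶ Z}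
    (hf : f ≫ e.hom = f') (hg : e.hom ≫ g' = g) : Triangle.mk f' g' h ∈ distTriang T :=
  distinguished_of_isos H (Iso.refl _) e (Iso.refl _) (by simp [hf]) (by simp [hg]) (by simp)

lemma distinguished_neg₁₃ {X Y Z : T} {f : X ⟶ Y} {g : Y ⟶ Z} {h : Z ⟶ X⟦(1 : ℤ)⟧}
    (H : Triangle.mk f g h ∈ distTriang T) : Triangle.mk (-f) g (-h) ∈ distTriang T :=
  distinguished_of_isos H (-Iso.refl _) (Iso.refl _) (Iso.refl _) (by simp) (by simp) (by simp)

section Exactness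

variable {W X Y Z : T} {f : X ⟶ Y} {g : Y ⟶ Z} {h : Z ⟶ X⟦(1 : ℤ)⟧}

lemma exists_fac_mor₂ (H : Triangle.mk f g h ∈ distTriang T) (φ : Y ⟶ W) (hφ : f ≫ φ = 0) :
    ∃ ψ : Z ⟶ W, φ = g ≫ ψ :=
  Triangle.yoneda_exact₂ _ H φ hφ

lemma exists_fac_mor₃ (H : Triangle.mk f g h ∈ distTriang T) (φ : Z ⟶ W) (hφ : g ≫ φ = 0) :
    ∃ ψ : X⟦(1 : ℤ)⟧ ⟶ W, φ = h ≫ ψ :=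
  Triangle.yoneda_exact₃ _ H φ hφ

lemma exists_lift_mor₂ (H : Triangle.mk f g h ∈ distTriang T) (φ : W ⟶ Z) (hφ : φ ≫ h = 0) :
    ∃ ψ : W ⟶ Y, φ = ψ ≫ g :=
  Triangle.coyoneda_exact₃ _ H φ hφ

lemma exists_lift_mor₃ (H : Triangle.mk f g h ∈ distTriang T) (φ : W ⟶ X⟦(1 : ℤ)⟧)
    (hφ : φ ≫ f⟦(1 : ℤ)⟧' = 0) : ∃ ψ : W ⟶ Z, φ = ψ ≫ h :=
  Triangle.coyoneda_exact₁ _ H φ hφ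

lemma comp_mor₁₂ (H : Triangle.mk f g h ∈ distTriang T) : f ≫ g = 0 :=
  comp_distTriang_mor_zero₁₂ _ H

lemma comp_mor₂₃ (H : Triangle.mk f g h ∈ distTriang T) : g ≫ h = 0 :=
  comp_distTriang_mor_zero₂₃ _ H

lemma comp_mor₃₁ (H : Triangle.mk f g h ∈ distTriang T) : h ≫ f⟦(1 : ℤ)⟧' = 0 :=
  comp_distTriang_mor_zero₃₁ _ H

lemma exists_iso_biprod (H : Triangle.mk f g h ∈ distTriang T) (h₀ : h = 0) :
    ∃ e : Y ≅ X ⊞ Z, f ≫ e.hom = biprod.inl ∧ g = e.hom ≫ biprod.snd :=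
  exists_iso_binaryBiproduct_of_distTriang _ H h₀

end Exactness

/-- The automorphism of `X ⊞ Y` which changes the sign on `Y`. -/
@[simps]
def biprodNegSnd (X Y : T) : X ⊞ Y ≅ X ⊞ Y where
  hom := biprod.map (𝟙 X) (-𝟙 Y)
  inv := biprod.map (𝟙 X) (-𝟙 Y)

/-- The automorphism of `X ⊞ Y` given by a morphism `Y ⟶ X`. -/
@[simps]
def biprodShear {X Y : T} (r : Y ⟶ X) : X ⊞ Y ≅ X ⊞ Y where
  hom := 𝟙 _ + biprod.snd ≫ r ≫ biprod.inl
  inv := 𝟙 _ - biprod.snd ≫ r ≫ biprod.inl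

/-- The automorphism of `X ⊞ Y` given by a morphism `X ⟶ Y`. -/
@[simps]
def biprodShear' {X Y : T} (r : X ⟶ Y) : X ⊞ Y ≅ X ⊞ Y where
  hom := 𝟙 _ + biprod.fst ≫ r ≫ biprod.inr
  inv := 𝟙 _ - biprod.fst ≫ r ≫ biprod.inr

variable [IsTriangulated T]

/-- Given the triangles on `f` and on `h = f ≫ g`, the morphism `D ⟶ E` can be chosen so that the
square formed by `g`, `f'`, `h'`, `k` is homotopy cartesian. -/
lemma exists_homotopyCartesian {A B C D E : T} {f : A ⟶ B} {f' : B ⟶ D} {f'' : D ⟶ A⟦(1 : ℤ)⟧}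
    {h : A ⟶ C} {h' : C ⟶ E} {h'' : E ⟶ A⟦(1 : ℤ)⟧} {g : B ⟶ C}
    (Hf : Triangle.mk f f' f'' ∈ distTriang T) (Hh : Triangle.mk h h' h'' ∈ distTriang T)
    (comm : f ≫ g = h) :
    ∃ k : D ⟶ E, k ≫ h'' = f'' ∧
      Triangle.mk (biprod.lift g f') (biprod.desc h' (-k)) (h'' ≫ f⟦(1 : ℤ)⟧') ∈ distTriang T := by
  have H₁₂ : Triangle.mk f' f'' (-f⟦(1 : ℤ)⟧') ∈ distTriang T := rot_of_distTriang _ Hf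
  have H₂₃ : Triangle.mk h'' (-h⟦(1 : ℤ)⟧') (-h'⟦(1 : ℤ)⟧') ∈ distTriang T :=
    rot_of_distTriang _ (rot_of_distTriang _ Hh)
  have H₁₃ : Triangle.mk (biprod.snd : C ⊞ D ⟶ D) 0 (-(biprod.inl : C ⟶ C ⊞ D)⟦(1 : ℤ)⟧') ∈
      distTriang T := rot_of_distTriang _ (binaryBiproductTriangle_distinguished C D)
  have zero : f'' ≫ (-h⟦(1 : ℤ)⟧') = 0 := by
    rw [← comm, Functor.map_comp, Preadditive.comp_neg, reassoc_of% comp_mor₃₁ Hf,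
      Limits.zero_comp, neg_zero]
  -- The octahedral axiom is applied to the zero composite `D ⟶ A⟦1⟧ ⟶ C⟦1⟧`, whose fibre is `C ⊞
  -- D`.
  obtain ⟨m₁, m₃, c₁, c₂, c₃, c₄, mem⟩ := Triangulated.someOctahedron' zero H₁₂ H₂₃ H₁₃
  have d₂ : f ≫ m₁ = -(h ≫ biprod.inl) := by
    apply (shiftFunctor T (1 : ℤ)).map_injective
    simpa [neg_eq_iff_eq_neg] using c₂
  have d₃ : biprod.inl ≫ m₃ = h' := by
    apply (shiftFunctor T (1 : ℤ)).map_injective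
    simpa using c₃
  -- Up to sign, the `C`-component of `m₁` agrees with `g` only after composing with `f`. The
  -- discrepancy factors through `f'` as `ζ : D ⟶ C`, and a shear of `C ⊞ D` removes it.
  obtain ⟨ζ, hζ⟩ := exists_fac_mor₂ Hf (-(m₁ ≫ biprod.fst) - g) (by
    rw [Preadditive.comp_sub, Preadditive.comp_neg, reassoc_of% d₂]
    simp [comm])
  rw [sub_eq_iff_eq_add] at hζ
  refine ⟨biprod.inr ≫ m₃ - ζ ≫ h', ?_, ?_⟩
  · simp [c₄, comp_mor₂₃ Hh]
  · have mem' := distinguished_neg₁₃ mem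
    rw [Preadditive.comp_neg, neg_neg] at mem'
    refine distinguished_of_iso₂ mem' (biprodNegSnd _ _ ≪≫ biprodShear (-ζ)) ?_ ?_
    · ext
      · simp [hζ, reassoc_of% c₁]
      · simp [c₁]
    · ext
      · simp [d₃]
      · simp

/-- Given the triangles on `g` and on `h = f ≫ g`, the morphism `E ⟶ F` can be chosen so that the
square formed by `k'`, `h''`, `g''`, `f⟦1⟧'` is homotopy cartesian. -/
lemma exists_homotopyCartesian_shift {A B C E F : T} {f : A ⟶ B}
    {h : A ⟶ C} {h' : C ⟶ E} {h'' : E ⟶ A⟦(1 : ℤ)⟧} {g : B ⟶ C} {g' : C ⟶ F}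
    {g'' : F ⟶ B⟦(1 : ℤ)⟧}
    (Hg : Triangle.mk g g' g'' ∈ distTriang T) (Hh : Triangle.mk h h' h'' ∈ distTriang T)
    (comm : f ≫ g = h) :
    ∃ k' : E ⟶ F, h' ≫ k' = g' ∧
      Triangle.mk (g ≫ h') (biprod.lift k' (-h'')) (biprod.desc g'' (f⟦(1 : ℤ)⟧')) ∈
        distTriang T := by
  have H₂₃ : Triangle.mk g' g'' (-g⟦(1 : ℤ)⟧') ∈ distTriang T := rot_of_distTriang _ Hg
  have H₁₃ : Triangle.mk (0 : A ⟶ F) (biprod.inl : F ⟶ F ⊞ A⟦(1 : ℤ)⟧) biprod.snd ∈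
      distTriang T := by
    rw [rotate_distinguished_triangle]
    change Triangle.mk biprod.inl biprod.snd (-(0 : A ⟶ F)⟦(1 : ℤ)⟧') ∈ distTriang T
    rw [Functor.map_zero, neg_zero]
    exact binaryBiproductTriangle_distinguished F (A⟦(1 : ℤ)⟧)
  have zero : h ≫ g' = 0 := by
    rw [← comm, Category.assoc, comp_mor₁₂ Hg, Limits.comp_zero]
  -- Here the zero composite is `A ⟶ C ⟶ F`, with cone `F ⊞ A⟦1⟧`.
  obtain ⟨m₁, m₃, c₁, c₂, c₃, c₄, mem⟩ := Triangulated.someOctahedron zero Hh H₂₃ H₁₃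
  have mem' : Triangle.mk (g ≫ h') m₁ m₃ ∈ distTriang T := by
    rw [rotate_distinguished_triangle]
    change Triangle.mk m₁ m₃ (-(g ≫ h')⟦(1 : ℤ)⟧') ∈ distTriang T
    rwa [Functor.map_comp, ← Preadditive.neg_comp]
  have d₄ : (biprod.inr ≫ m₃) ≫ g⟦(1 : ℤ)⟧' = -h⟦(1 : ℤ)⟧' := by
    have := biprod.inr ≫= c₄
    simp at this
    simp [this]
  -- Up to sign, `m₃` on `A⟦1⟧` agrees with `f⟦1⟧'` only after composing with `g⟦1⟧'`; the
  -- discrepancy lifts along `g''`.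
  obtain ⟨η, hη⟩ := exists_lift_mor₃ Hg (-(biprod.inr ≫ m₃) - f⟦(1 : ℤ)⟧') (by
    rw [Preadditive.sub_comp, Preadditive.neg_comp, d₄, ← Functor.map_comp, comm]
    simp)
  rw [sub_eq_iff_eq_add, neg_eq_iff_eq_neg] at hη
  refine ⟨m₁ ≫ biprod.fst - h'' ≫ η, ?_, ?_⟩
  · simp [reassoc_of% c₁, reassoc_of% comp_mor₂₃ Hh]
  · refine distinguished_of_iso₃ mem' (biprodNegSnd _ _ ≪≫ biprodShear η) ?_ ?_
    · ext
      · simp [← c₂, sub_eq_add_neg]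
      · simp [← c₂]
    · ext
      · simp [c₃]
      · simp [hη]

end Abstract

/-! ### Calculus of the multiples of `y`, and the cone of `x^a`. -/

section Calculus

variable (K : Type u) [Field K] [HasDerivedCategory.{w} (FGModuleCat.{u} K[X])]

/-- The morphism `p • y : R_m ⟶ R_n⟦1⟧`, for a polynomial `p`. -/
def yPoly (p : K[X]) (m n : ℕ) : truncObj K m ⟶ (truncObj K n)⟦(1 : ℤ)⟧ :=
  mulPoly K p m m (dvd_mul_right _ _) ≫ yExt K m n

variable {K}

lemma yExt_eq_yPoly (m n : ℕ) : yExt K m n = yPoly K 1 m n := by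
  rw [yPoly, mulPoly_one, Category.id_comp]

/-- Naturality moves `p * q` to the target of `y` as `s`, and then `s` back to the source. The
hypothesis on `s` expresses the quotient `x^(m-m') p q` without division. -/
lemma mulPoly_comp_yPoly {p q s : K[X]} {m m' n : ℕ} (h : (X ^ m' : K[X]) ∣ X ^ m * p)
    (hs : X ^ m' * s = X ^ m * (p * q)) :
    mulPoly K p m m' h ≫ yPoly K q m' n = yPoly K s m n := by
  rw [yPoly, ← Category.assoc, mulPoly_comp, yPoly,
    ← yExt_naturality (p * q) s _ (dvd_mul_right _ _) hs,
    ← yExt_naturality s s _ (dvd_mul_right _ _) rfl]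

lemma yPoly_comp_mulPoly (p q : K[X]) {m n n' : ℕ} (h : (X ^ n' : K[X]) ∣ X ^ n * q) :
    yPoly K p m n ≫ (mulPoly K q n n' h)⟦(1 : ℤ)⟧' = yPoly K (p * q) m n' := by
  rw [yPoly, Category.assoc, yExt_naturality q q (dvd_mul_right _ _) h rfl, ← Category.assoc,
    mulPoly_comp, yPoly]

lemma xPow_comp_yPoly {i m m' n : ℕ} (h : m' ≤ m + i) (q : K[X]) :
    xPow K i m m' h ≫ yPoly K q m' n = yPoly K (X ^ (m + i - m') * q) m n := by
  rw [xPow_eq_mulPoly]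
  refine mulPoly_comp_yPoly _ ?_
  rw [← mul_assoc, ← mul_assoc, ← pow_add, ← pow_add, Nat.add_sub_cancel' h]

lemma yPoly_comp_xPow (p : K[X]) {i m n n' : ℕ} (h : n' ≤ n + i) :
    yPoly K p m n ≫ (xPow K i n n' h)⟦(1 : ℤ)⟧' = yPoly K (p * X ^ i) m n' := by
  rw [xPow_eq_mulPoly, yPoly_comp_mulPoly]

lemma xPow_comp_xPow {i j l m n : ℕ} (h : m ≤ l + i) (h' : n ≤ m + j) :
    xPow K i l m h ≫ xPow K j m n h' = xPow K (i + j) l n (by omega) := by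
  simp only [xPow_eq_mulPoly, mulPoly_comp, pow_add]

lemma xPow_comp_xPow_assoc {i j l m n : ℕ} (h : m ≤ l + i) (h' : n ≤ m + j) {Z : Db0 K}
    (φ : truncObj K n ⟶ Z) :
    xPow K i l m h ≫ xPow K j m n h' ≫ φ = xPow K (i + j) l n (by omega) ≫ φ := by
  rw [← Category.assoc, xPow_comp_xPow]

lemma yPoly_add (p q : K[X]) (m n : ℕ) :
    yPoly K (p + q) m n = yPoly K p m n + yPoly K q m n := by
  rw [yPoly, mulPoly_add _ _ _ _ (dvd_mul_right _ _) (dvd_mul_right _ _), Preadditive.add_comp,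
    yPoly, yPoly]

lemma yPoly_neg (p : K[X]) (m n : ℕ) : yPoly K (-p) m n = -yPoly K p m n := by
  rw [yPoly, mulPoly_neg _ _ _ (dvd_mul_right _ _), Preadditive.neg_comp, yPoly]

lemma yPoly_eq_zero_of_dvd_left {p : K[X]} {m : ℕ} (n : ℕ) (h : (X ^ m : K[X]) ∣ p) :
    yPoly K p m n = 0 := by
  rw [yPoly, mulPoly_eq_zero h, Limits.zero_comp]

lemma yPoly_eq_zero_of_dvd_right {p : K[X]} (m : ℕ) {n : ℕ} (h : (X ^ n : K[X]) ∣ p) :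
    yPoly K p m n = 0 := by
  rw [yPoly, ← yExt_naturality p p _ (dvd_mul_right _ _) rfl, mulPoly_eq_zero h, Functor.map_zero,
    Limits.comp_zero]

lemma yPoly_zero (m n : ℕ) : yPoly K 0 m n = 0 :=
  yPoly_eq_zero_of_dvd_left n (dvd_zero _)

/-- If `p • y` vanishes, multiplication by `p` on `R_m` lifts to a map `R_m ⟶ R_{n+m}`. Such a map
is multiplication by a multiple of `x^n`, so `p` vanishes modulo `x`. -/
lemma X_dvd_of_yPoly_eq_zero {p : K[X]} {m n : ℕ} (hm : m ≠ 0) (hn : n ≠ 0)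
    (h : yPoly K p m n = 0) : X ∣ p := by
  obtain ⟨ψ, hψ⟩ := exists_lift_mor₂ (powTriangle_distinguished m n (n + m) rfl) _ h
  obtain ⟨q, hq, rfl⟩ := exists_eq_mulPoly ψ
  rw [xPow_eq_mulPoly, mulPoly_comp] at hψ
  have h₁ : (X : K[X]) ∣ p - q * X ^ 0 := (dvd_pow_self X hm).trans (dvd_of_mulPoly_eq hψ)
  have h₂ : (X : K[X]) ∣ q := by
    rw [pow_add, mul_comm] at hq
    exact (dvd_pow_self X hn).trans ((mul_dvd_mul_iff_left (pow_ne_zero m X_ne_zero)).1 hq)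
  exact (dvd_sub_left (h₂.mul_right _)).1 h₁

lemma shift_mulPoly_eq {m n : ℕ} (φ : (truncObj K m)⟦(1 : ℤ)⟧ ⟶ (truncObj K n)⟦(1 : ℤ)⟧) :
    ∃ (p : K[X]) (h : (X ^ n : K[X]) ∣ X ^ m * p), φ = (mulPoly K p m n h)⟦(1 : ℤ)⟧' := by
  obtain ⟨ψ, rfl⟩ := (shiftFunctor (Db0 K) (1 : ℤ)).map_surjective φ
  obtain ⟨p, h, rfl⟩ := exists_eq_mulPoly ψ
  exact ⟨p, h, rfl⟩

/-- The first class is pulled from a class with values in `R_{n+m}`, and the map `R_{n+m} ⟶ R_m`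
composes to zero with the second class. -/
lemma yExt_comp_shift_yExt (l m n : ℕ) : yExt K l m ≫ (yExt K m n)⟦(1 : ℤ)⟧' = 0 := by
  have h : yExt K l m = yExt K l (n + m) ≫ (xPow K 0 (n + m) m)⟦(1 : ℤ)⟧' := by
    rw [yExt_eq_yPoly, yExt_eq_yPoly, yPoly_comp_xPow, pow_zero, mul_one]
  rw [h, Category.assoc, ← Functor.map_comp, comp_mor₂₃ (powTriangle_distinguished m n _ rfl),
    Functor.map_zero, Limits.comp_zero]

/-- The triangle on multiplication by `x ^ a` on `R_N`. -/
lemma xPow_triangle_distinguished (a b N : ℕ) (hN : N = a + b) :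
    Triangle.mk (xPow K a N N (by omega))
      (biprod.lift (yExt K N a) (xPow K 0 N a (by omega)))
      (biprod.desc (-(xPow K b a N (by omega))⟦(1 : ℤ)⟧') (yExt K a N)) ∈ distTriang (Db0 K) := by
  obtain ⟨C, v, w, H⟩ := distinguished_cocone_triangle (xPow K a N N (by omega))
  have H₁₂ : Triangle.mk (xPow K 0 N b (by omega)) (yExt K b a)
      (-(xPow K b a N (by omega))⟦(1 : ℤ)⟧') ∈ distTriang (Db0 K) :=
    rot_of_distTriang _ (powTriangle_distinguished b a N hN)
  have H₂₃ := powTriangle_distinguished (K := K) a b N (by omega)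
  have comm : xPow K 0 N b (by omega) ≫ xPow K a b N (by omega) = xPow K a N N (by omega) := by
    rw [xPow_comp_xPow]
    congr 1
    omega
  -- Factoring `x^a` as `R_N ⟶ R_b ⟶ R_N` exhibits its cone as an extension of `R_a` by `R_a⟦1⟧`.
  -- The extension splits because its connecting morphism is a composite of two classes `y`.
  obtain ⟨m₁, m₃, c₁, c₂, c₃, -, mem⟩ := Triangulated.someOctahedron comm H₁₂ H₂₃ H
  obtain ⟨e, he₁, rfl⟩ := exists_iso_biprod mem (yExt_comp_shift_yExt a b a)
  -- The splitting is adjusted by a shear so that the first component of the map into the cone is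
  -- exactly `y`.
  obtain ⟨s, hs⟩ := exists_fac_mor₂ H₂₃ (v ≫ e.hom ≫ biprod.fst - yExt K N a) (by
    rw [Preadditive.comp_sub, ← reassoc_of% c₁, reassoc_of% he₁, yExt_eq_yPoly, yExt_eq_yPoly,
      xPow_comp_yPoly]
    simp [hN, add_comm])
  rw [sub_eq_iff_eq_add] at hs
  obtain ⟨β, hβ⟩ : ∃ β, β = biprod.inr ≫ (biprodShear (-s)).inv ≫ e.inv ≫ w := ⟨_, rfl⟩
  have H' : Triangle.mk (xPow K a N N (by omega))
      (biprod.lift (yExt K N a) (xPow K 0 N a (by omega)))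
      (biprod.desc (-(xPow K b a N (by omega))⟦(1 : ℤ)⟧') β) ∈ distTriang (Db0 K) := by
    refine distinguished_of_iso₃ H (e ≪≫ biprodShear (-s)) ?_ ?_
    · apply biprod.hom_ext
      · simp [hs, reassoc_of% c₃]
      · simp [c₃]
    · have : w = (e ≪≫ biprodShear (-s)).hom ≫ (biprodShear (-s)).inv ≫ e.inv ≫ w := by simp
      rw [this]
      congr 1
      apply biprod.hom_ext'
      · have hm : biprod.inl ≫ e.inv = m₁ := by rw [← he₁, Category.assoc, e.hom_inv_id,
          Category.comp_id]
        simp [← c₂, reassoc_of% hm]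
      · simp [hβ]
  -- The component `β` on `R_a` is now forced: `β - y` factors through `y : R_a ⟶ R_b⟦1⟧` followed
  -- by a multiple of `x^a`, which annihilates classes on `R_a`.
  obtain ⟨τ, hτ⟩ := exists_fac_mor₃ H₂₃ (β - yExt K a N) (by
    have h₀ := comp_mor₂₃ H'
    rw [biprod.lift_desc, Preadditive.comp_neg, neg_add_eq_zero, yExt_eq_yPoly,
      yPoly_comp_xPow] at h₀
    rw [Preadditive.comp_sub, ← h₀, yExt_eq_yPoly, xPow_comp_yPoly]
    simp [hN])
  obtain ⟨p, hp, rfl⟩ := shift_mulPoly_eq τ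
  have hz : yPoly K (1 * p) a N = 0 := by
    apply yPoly_eq_zero_of_dvd_left
    rw [hN, pow_add, mul_comm] at hp
    rw [one_mul]
    exact (mul_dvd_mul_iff_left (pow_ne_zero b X_ne_zero)).1 hp
  rw [yExt_eq_yPoly a b, yPoly_comp_mulPoly, hz, sub_eq_zero] at hτ
  rwa [hτ] at H'

end Calculus

/-! ### The family of good octahedra parametrised by `p`. -/

section Octahedra

variable (K : Type u) [Field K] [HasDerivedCategory.{w} (FGModuleCat.{u} K[X])]

/-- The morphism `R_3 ⟶ R_a⟦1⟧ ⊞ R_a` with components `y` and `x^0`. -/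
abbrev toCone (a : ℕ) (h : a ≤ 3 := by omega) :
    truncObj K 3 ⟶ (truncObj K a)⟦(1 : ℤ)⟧ ⊞ truncObj K a :=
  biprod.lift (yExt K 3 a) (xPow K 0 3 a)

/-- The morphism `R_a⟦1⟧ ⊞ R_a ⟶ R_3⟦1⟧` with components `-x^(3-a)` and `y`. -/
abbrev fromCone (a b : ℕ) (h : 3 ≤ a + b := by omega) :
    (truncObj K a)⟦(1 : ℤ)⟧ ⊞ truncObj K a ⟶ (truncObj K 3)⟦(1 : ℤ)⟧ :=
  biprod.desc (-(xPow K b a 3)⟦(1 : ℤ)⟧') (yExt K a 3)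

/-- The morphism `R_1⟦1⟧ ⊞ R_1 ⟶ R_2⟦1⟧ ⊞ R_2` with matrix `(x z; 0 x)`. -/
abbrev mulXMatrix (z : truncObj K 1 ⟶ (truncObj K 2)⟦(1 : ℤ)⟧) :
    (truncObj K 1)⟦(1 : ℤ)⟧ ⊞ truncObj K 1 ⟶ (truncObj K 2)⟦(1 : ℤ)⟧ ⊞ truncObj K 2 :=
  biprodMatrix ((xPow K 1 1 2)⟦(1 : ℤ)⟧') z 0 (xPow K 1 1 2)

/-- The morphism `R_2⟦1⟧ ⊞ R_2 ⟶ R_1⟦1⟧ ⊞ R_1` with matrix `(1 z; 0 1)`. -/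
abbrev reductionMatrix (z : truncObj K 2 ⟶ (truncObj K 1)⟦(1 : ℤ)⟧) :
    (truncObj K 2)⟦(1 : ℤ)⟧ ⊞ truncObj K 2 ⟶ (truncObj K 1)⟦(1 : ℤ)⟧ ⊞ truncObj K 1 :=
  biprodMatrix ((xPow K 0 2 1)⟦(1 : ℤ)⟧') z 0 (xPow K 0 2 1)

variable {K}

lemma toCone_comp_mulXMatrix (p : K[X]) :
    toCone K 1 ≫ mulXMatrix K (yPoly K p 1 2) = xPow K 1 3 3 ≫ toCone K 2 := by
  apply biprod.hom_ext
  · have h : yPoly K (X ^ 2 * p) 3 2 = 0 :=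
      yPoly_eq_zero_of_dvd_right _ (dvd_mul_right _ _)
    simp [biprodMatrix, yExt_eq_yPoly, xPow_comp_yPoly, yPoly_comp_xPow, h]
  · simp [biprodMatrix, xPow_comp_xPow]

lemma toCone_comp_reductionMatrix (p : K[X]) :
    toCone K 2 ≫ reductionMatrix K (yPoly K p 2 1) = toCone K 1 := by
  apply biprod.hom_ext
  · have h : yPoly K (X * p) 3 1 = 0 :=
      yPoly_eq_zero_of_dvd_right _ (by simp)
    simp [biprodMatrix, yExt_eq_yPoly, xPow_comp_yPoly, yPoly_comp_xPow, h]
  · simp [biprodMatrix, xPow_comp_xPow]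

lemma mulXMatrix_comp_fromCone (p : K[X]) :
    mulXMatrix K (yPoly K p 1 2) ≫ fromCone K 2 1 = fromCone K 1 2 := by
  apply biprod.hom_ext'
  · simp [biprodMatrix, xPow_comp_xPow, ← Functor.map_comp]
  · have h : yPoly K (p * X) 1 3 = 0 :=
      yPoly_eq_zero_of_dvd_left _ (by simp)
    simp [biprodMatrix, yExt_eq_yPoly, xPow_comp_yPoly, yPoly_comp_xPow, h]

lemma reductionMatrix_comp_fromCone (p : K[X]) :
    reductionMatrix K (yPoly K p 2 1) ≫ fromCone K 1 2 =
      fromCone K 2 1 ≫ (xPow K 1 3 3)⟦(1 : ℤ)⟧' := by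
  apply biprod.hom_ext'
  · simp [biprodMatrix, xPow_comp_xPow, ← Functor.map_comp]
  · have h : yPoly K (p * X ^ 2) 2 3 = 0 :=
      yPoly_eq_zero_of_dvd_left _ (dvd_mul_left _ _)
    simp [biprodMatrix, yExt_eq_yPoly, xPow_comp_yPoly, yPoly_comp_xPow, h]

lemma xPow_triangle₁ : Triangle.mk (xPow K 1 3 3) (toCone K 1) (fromCone K 1 2) ∈
    distTriang (Db0 K) :=
  xPow_triangle_distinguished 1 2 3 rfl

lemma xPow_triangle₂ : Triangle.mk (xPow K 2 3 3) (toCone K 2) (fromCone K 2 1) ∈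
    distTriang (Db0 K) :=
  xPow_triangle_distinguished 2 1 3 rfl

/-- The difference between `k` and the diagonal matrix factors as `D ⟶ R_3 ⟶ E`. Nothing nonzero
maps `R_1⟦1⟧` to `R_3`, and a map `R_1 ⟶ R_3` is multiplication by some `x^2 q`: it dies in `R_2`
and contributes `q • y` in the corner. -/
lemma exists_eq_mulXMatrix
    (k : (truncObj K 1)⟦(1 : ℤ)⟧ ⊞ truncObj K 1 ⟶ (truncObj K 2)⟦(1 : ℤ)⟧ ⊞ truncObj K 2)
    (hk : k ≫ fromCone K 2 1 = fromCone K 1 2) : ∃ p, k = mulXMatrix K (yPoly K p 1 2) := by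
  obtain ⟨ε, hε⟩ := exists_lift_mor₂ xPow_triangle₂ (k - mulXMatrix K (yPoly K 0 1 2)) (by
    rw [Preadditive.sub_comp, hk, mulXMatrix_comp_fromCone, sub_self])
  obtain ⟨p, hp, h₂⟩ := exists_eq_mulPoly (biprod.inr ≫ ε)
  have h₁ := eq_zero_of_shift_to_truncObj (biprod.inl ≫ ε)
  obtain ⟨q, rfl⟩ : (X ^ 2 : K[X]) ∣ p := by
    rw [pow_succ', pow_one] at hp
    exact (mul_dvd_mul_iff_left X_ne_zero).1 hp
  have hy : biprod.inr ≫ ε ≫ yPoly K 1 3 2 = yPoly K q 1 2 := by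
    rw [← Category.assoc, h₂]
    exact mulPoly_comp_yPoly _ (by ring)
  have hx : biprod.inr ≫ ε ≫ xPow K 0 3 2 = 0 := by
    rw [← Category.assoc, h₂, xPow_eq_mulPoly, mulPoly_comp]
    exact mulPoly_eq_zero (by simp)
  rw [sub_eq_iff_eq_add] at hε
  refine ⟨q, ?_⟩
  rw [hε]
  apply biprod.hom_ext' <;> apply biprod.hom_ext
  · simp [biprodMatrix, reassoc_of% h₁]
  · simp [biprodMatrix, reassoc_of% h₁]
  · simp [biprodMatrix, yExt_eq_yPoly, hy, yPoly_zero]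
  · simp [biprodMatrix, hx]

/-- Dual argument: the difference factors as `E ⟶ R_3⟦1⟧ ⟶ F`, and only the part landing in `R_1⟦1⟧`
survives. -/
lemma exists_eq_reductionMatrix
    (k : (truncObj K 2)⟦(1 : ℤ)⟧ ⊞ truncObj K 2 ⟶ (truncObj K 1)⟦(1 : ℤ)⟧ ⊞ truncObj K 1)
    (hk : toCone K 2 ≫ k = toCone K 1) : ∃ p, k = reductionMatrix K (yPoly K p 2 1) := by
  obtain ⟨ε, hε⟩ := exists_fac_mor₃ xPow_triangle₂ (k - reductionMatrix K (yPoly K 0 2 1)) (by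
    rw [Preadditive.comp_sub, hk, toCone_comp_reductionMatrix, sub_self])
  obtain ⟨p, hp, h₁⟩ := shift_mulPoly_eq (ε ≫ biprod.fst)
  have h₂ := eq_zero_of_shift_to_truncObj (ε ≫ biprod.snd)
  have hx : (xPow K 1 2 3)⟦(1 : ℤ)⟧' ≫ ε ≫ biprod.fst = 0 := by
    rw [h₁, ← Functor.map_comp, xPow_eq_mulPoly, mulPoly_comp, mulPoly_eq_zero (by simp),
      Functor.map_zero]
  rw [sub_eq_iff_eq_add] at hε
  refine ⟨p, ?_⟩
  rw [hε]
  apply biprod.hom_ext' <;> apply biprod.hom_ext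
  · simp [biprodMatrix, hx]
  · simp [biprodMatrix, h₂]
  · simp [biprodMatrix, yExt_eq_yPoly, h₁, yPoly_comp_mulPoly, yPoly_zero]
  · simp [biprodMatrix, h₂]

/-- The automorphism of `R_2⟦1⟧ ⊞ R_2` given by a multiple of `y`. -/
abbrev shearE (r : K[X]) :
    (truncObj K 2)⟦(1 : ℤ)⟧ ⊞ truncObj K 2 ≅ (truncObj K 2)⟦(1 : ℤ)⟧ ⊞ truncObj K 2 :=
  biprodShear (yPoly K r 2 2)

lemma mulXMatrix_comp_shear (p r : K[X]) : mulXMatrix K (yPoly K p 1 2) ≫ (shearE r).hom =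
    mulXMatrix K (yPoly K (p + r) 1 2) := by
  apply biprod.hom_ext' <;> apply biprod.hom_ext <;>
  simp [biprodMatrix, xPow_comp_yPoly, yPoly_add]

lemma shear_comp_reductionMatrix (p r : K[X]) :
    (shearE r).hom ≫ reductionMatrix K (yPoly K p 2 1) =
    reductionMatrix K (yPoly K (p + r) 2 1) := by
  apply biprod.hom_ext' <;> apply biprod.hom_ext <;>
  simp [biprodMatrix, yPoly_comp_xPow, yPoly_add]

lemma mulXMatrix_triangle (p : K[X]) :
    Triangle.mk (mulXMatrix K (yPoly K p 1 2)) (reductionMatrix K (-yPoly K p 2 1))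
      (fromCone K 1 2 ≫ (toCone K 1)⟦(1 : ℤ)⟧') ∈ distTriang (Db0 K) := by
  have comm : xPow K 1 3 3 ≫ xPow K 1 3 3 = xPow K 2 3 3 := by rw [xPow_comp_xPow]
  obtain ⟨m₁, m₃, -, c₂, c₃, -, mem⟩ :=
    Triangulated.someOctahedron comm xPow_triangle₁ xPow_triangle₁ (xPow_triangle₂ (K := K))
  obtain ⟨q, rfl⟩ := exists_eq_mulXMatrix m₁ c₂
  obtain ⟨s, rfl⟩ := exists_eq_reductionMatrix m₃ c₃
  have hqs : (X ^ 1 : K[X]) ∣ q + s := by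
    have h := biprod.inr ≫= comp_mor₁₂ mem =≫ biprod.fst
    simp [biprodMatrix, yPoly_comp_xPow, xPow_comp_yPoly, ← yPoly_add] at h
    simpa using X_dvd_of_yPoly_eq_zero one_ne_zero one_ne_zero h
  -- The shear taking `q` to `p` takes `s` to `s - (p - q)`. This is congruent to `-p` modulo `x`,
  -- which is enough since `x` annihilates classes with values in `R_1⟦1⟧`.
  have hs : yPoly K (s - (p - q)) 2 1 = -yPoly K p 2 1 := by
    rw [eq_neg_iff_add_eq_zero, ← yPoly_add]
    apply yPoly_eq_zero_of_dvd_right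
    rwa [show s - (p - q) + p = q + s by ring]
  refine distinguished_of_iso₂ mem (shearE (p - q)) ?_ ?_
  · rw [mulXMatrix_comp_shear, add_sub_cancel]
  · rw [← hs, shear_comp_reductionMatrix, sub_add_cancel]

lemma mulXMatrix_homotopyCartesian (p : K[X]) :
    Triangle.mk (biprod.lift (xPow K 1 3 3) (toCone K 1))
      (biprod.desc (toCone K 2) (-mulXMatrix K (yPoly K p 1 2)))
      (fromCone K 2 1 ≫ (xPow K 1 3 3)⟦(1 : ℤ)⟧') ∈ distTriang (Db0 K) := by
  obtain ⟨k, hk, mem⟩ := exists_homotopyCartesian xPow_triangle₁ (xPow_triangle₂ (K := K))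
    (g := xPow K 1 3 3) (by rw [xPow_comp_xPow])
  obtain ⟨q, rfl⟩ := exists_eq_mulXMatrix k hk
  obtain ⟨r, rfl⟩ : ∃ r, p = q + r := ⟨p - q, by ring⟩
  -- The shear of `E` changes `h'` by `x r • y`; the component `-r • y` from `C` to the first
  -- summand of `D` cancels this after composing with `-k`.
  refine distinguished_of_isos mem (Iso.refl _)
    (biprodShear' (biprod.lift (-yPoly K r 3 1) 0)) (shearE r) ?_ ?_ ?_
  · have h : yPoly K (X * r) 3 1 = 0 := yPoly_eq_zero_of_dvd_right _ (by simp)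
    apply biprod.hom_ext
    · simp
    · apply biprod.hom_ext <;> simp [xPow_comp_yPoly, h]
  · apply biprod.hom_ext'
    · apply biprod.hom_ext
      · simp [biprodMatrix, xPow_comp_yPoly, yPoly_comp_xPow, mul_comm]
      · simp [biprodMatrix]
    · rw [biprod.inr_desc_assoc, Preadditive.neg_comp, mulXMatrix_comp_shear]
      simp
  · have h : yPoly K (r * X ^ 2) 2 3 = 0 := yPoly_eq_zero_of_dvd_left _ (dvd_mul_left _ _)
    apply biprod.hom_ext' <;>
      simp [xPow_comp_xPow, ← Functor.map_comp, yPoly_comp_xPow, h]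

lemma reductionMatrix_homotopyCartesian (p : K[X]) :
    Triangle.mk (xPow K 1 3 3 ≫ toCone K 2)
      (biprod.lift (reductionMatrix K (yPoly K p 2 1)) (-fromCone K 2 1))
      (biprod.desc (fromCone K 1 2) ((xPow K 1 3 3)⟦(1 : ℤ)⟧')) ∈ distTriang (Db0 K) := by
  obtain ⟨k, hk, mem⟩ := exists_homotopyCartesian_shift xPow_triangle₁ (xPow_triangle₂ (K := K))
    (f := xPow K 1 3 3) (by rw [xPow_comp_xPow])
  obtain ⟨q, rfl⟩ := exists_eq_reductionMatrix k hk
  obtain ⟨r, rfl⟩ : ∃ r, q = p + r := ⟨q - p, by ring⟩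
  -- The shear of `E` also changes `h''`, and here a map from `A⟦1⟧` to `F` is replaced by one from
  -- `F` to `A⟦1⟧` with corner `r • y`.
  refine distinguished_of_isos mem (Iso.refl _) (shearE r)
    (biprodShear' (biprod.desc 0 (yPoly K r 1 3))) ?_ ?_ ?_
  · have h : yPoly K (X ^ 2 * r) 3 2 = 0 := yPoly_eq_zero_of_dvd_right _ (dvd_mul_right _ _)
    apply biprod.hom_ext <;> simp [xPow_comp_xPow_assoc, xPow_comp_xPow, xPow_comp_yPoly, h]
  · apply biprod.hom_ext
    · rw [Category.assoc, Category.assoc, biprod.lift_fst, shear_comp_reductionMatrix]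
      simp
    · apply biprod.hom_ext'
      · simp [biprodMatrix]
      · simp [biprodMatrix, xPow_comp_yPoly, yPoly_comp_xPow, mul_comm]
  · have h : yPoly K (r * X) 1 3 = 0 := yPoly_eq_zero_of_dvd_left _ (by simp)
    apply biprod.hom_ext'
    · apply biprod.hom_ext' <;> simp [yPoly_comp_xPow, h]
    · simp

lemma octahedronWith_isGoodOctahedron (p : K[X]) :
    (octahedronWith K (mulXMatrix K (yPoly K p 1 2))
      (reductionMatrix K (-yPoly K p 2 1))).IsGoodOctahedron := by
  have e := yPoly_neg p 2 1
  exact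
  { comm_h := rfl
    comm_l₁ := rfl
    comm_l₂ := (toCone_comp_mulXMatrix p).symm
    comm_f'' := rfl
    comm_g' := rfl
    comm_l'₁ := rfl
    comm_l'₂ := by
      have h := reductionMatrix_comp_fromCone (-p)
      rw [e] at h
      exact h.symm
    comm_k'' := rfl
    dist_f := by
      have h := xPow_triangle₁ (K := K)
      rw [← mulXMatrix_comp_fromCone p] at h
      exact h
    dist_h := by
      have h := xPow_triangle₂ (K := K)
      rw [show xPow K 2 3 3 = xPow K 1 3 3 ≫ xPow K 1 3 3 by rw [xPow_comp_xPow]] at h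
      exact h
    dist_g := by
      have h := xPow_triangle₁ (K := K)
      rw [← toCone_comp_reductionMatrix (-p), e] at h
      exact h
    dist_k := mulXMatrix_triangle p
    dist_l := by
      have h := reductionMatrix_homotopyCartesian (-p)
      rw [← toCone_comp_mulXMatrix p, e] at h
      exact h
    dist_l' := by
      have h := mulXMatrix_homotopyCartesian p
      rw [← reductionMatrix_comp_fromCone (-p), e] at h
      exact h }

end Octahedra

/-! ### No isomorphism between the octahedra for `p = 0` and `p = 1`. -/

section NonIsomorphic

variable {K : Type u} [Field K] [HasDerivedCategory.{w} (FGModuleCat.{u} K[X])]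

/-- The second column of an endomorphism of `R_a⟦1⟧ ⊞ R_a` compatible with endomorphisms of `R_3`
given by polynomials which are congruent modulo `x ^ a`. -/
lemma endomorphism_cone_components {a b : ℕ} (ha : a ≤ 3) (hb : 3 = a + b)
    {φ : (truncObj K a)⟦(1 : ℤ)⟧ ⊞ truncObj K a ⟶ (truncObj K a)⟦(1 : ℤ)⟧ ⊞ truncObj K a}
    {s t : K[X]} (hst : (X ^ a : K[X]) ∣ s - t)
    (h₁ : mulPoly K s 3 3 (dvd_mul_right _ _) ≫ toCone K a ha = toCone K a ha ≫ φ)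
    (h₂ : φ ≫ fromCone K a b hb.le =
      fromCone K a b hb.le ≫ (mulPoly K t 3 3 (dvd_mul_right _ _))⟦(1 : ℤ)⟧') :
    biprod.inr ≫ φ ≫ biprod.snd = mulPoly K s a a (dvd_mul_right _ _) ∧
      ∃ (q : K[X]) (hq : (X ^ b : K[X]) ∣ X ^ a * q),
        biprod.inr ≫ φ ≫ biprod.fst = mulPoly K q a b hq ≫ yExt K b a := by
  obtain ⟨p, hp, e⟩ := exists_eq_mulPoly (biprod.inr ≫ φ ≫ biprod.snd)
  have h₀ := eq_zero_of_shift_to_truncObj (biprod.inl ≫ φ ≫ biprod.snd)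
  have hsp : (X ^ a : K[X]) ∣ p - s := by
    have h := h₁ =≫ biprod.snd
    have hφ : φ ≫ biprod.snd = biprod.snd ≫ biprod.inr ≫ φ ≫ biprod.snd := by
      apply biprod.hom_ext' <;> simp [h₀]
    rw [Category.assoc, biprod.lift_snd, Category.assoc, hφ, biprod.lift_snd_assoc, e,
      xPow_eq_mulPoly, mulPoly_comp, mulPoly_comp] at h
    rw [dvd_sub_comm]
    simpa using dvd_of_mulPoly_eq h
  have e' : biprod.inr ≫ φ ≫ biprod.snd = mulPoly K s a a (dvd_mul_right _ _) := by
    rw [e]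
    exact mulPoly_congr _ _ hsp
  refine ⟨e', ?_⟩
  have hφ : biprod.inr ≫ φ = (biprod.inr ≫ φ ≫ biprod.fst) ≫ biprod.inl +
      (biprod.inr ≫ φ ≫ biprod.snd) ≫ biprod.inr := by
    apply biprod.hom_ext <;> simp
  -- Compatibility with `h₂` equates this composite with `(s - t) • y`, which vanishes on `R_a`. The
  -- corner therefore lifts along `y : R_b ⟶ R_a⟦1⟧`.
  have hz : (biprod.inr ≫ φ ≫ biprod.fst) ≫ (xPow K b a 3 hb.le)⟦(1 : ℤ)⟧' = 0 := by
    have h := biprod.inr ≫= h₂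
    have hl : biprod.inr ≫ φ ≫ fromCone K a b hb.le =
        -((biprod.inr ≫ φ ≫ biprod.fst) ≫ (xPow K b a 3 hb.le)⟦(1 : ℤ)⟧') + yPoly K s a 3 := by
      rw [← Category.assoc, hφ, e', Preadditive.add_comp, Category.assoc, Category.assoc _ _
        (fromCone K a b hb.le), biprod.inl_desc, biprod.inr_desc, Preadditive.comp_neg, yPoly]
    rw [hl, biprod.inr_desc_assoc, yExt_eq_yPoly, yPoly_comp_mulPoly, one_mul,
      ← eq_sub_iff_add_eq, sub_eq_add_neg, ← yPoly_neg, ← yPoly_add, ← sub_eq_add_neg,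
      yPoly_eq_zero_of_dvd_left _ (by rwa [dvd_sub_comm]), neg_eq_zero] at h
    exact h
  obtain ⟨ψ, hψ⟩ := exists_lift_mor₃ (powTriangle_distinguished b a 3 hb) _ hz
  obtain ⟨q, hq, rfl⟩ := exists_eq_mulPoly ψ
  exact ⟨q, hq, hψ⟩

lemma isEmpty_iso : IsEmpty (OctahedralDiagram.Iso
    (octahedronWith K (mulXMatrix K 0) (reductionMatrix K 0))
    (octahedronWith K (mulXMatrix K (yExt K 1 2)) (reductionMatrix K (-yExt K 2 1)))) := by
  refine ⟨fun I => ?_⟩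
  obtain ⟨a, ha, hA⟩ := exists_eq_mulPoly I.φA.hom
  obtain ⟨b, hb, hB⟩ := exists_eq_mulPoly I.φB.hom
  obtain ⟨b', hb', hB'⟩ := exists_eq_mulPoly I.φB.inv
  obtain ⟨c, hc, hC⟩ := exists_eq_mulPoly I.φC.hom
  have congr_of_comm : ∀ {s t : K[X]} {hs ht},
      mulPoly K s 3 3 hs ≫ xPow K 1 3 3 = xPow K 1 3 3 ≫ mulPoly K t 3 3 ht →
        (X ^ 2 : K[X]) ∣ s - t := by
    intro s t hs ht h
    rw [xPow_eq_mulPoly, mulPoly_comp, mulPoly_comp] at h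
    have h' := dvd_of_mulPoly_eq h
    rw [pow_one, mul_comm s, ← mul_sub, pow_succ'] at h'
    exact (mul_dvd_mul_iff_left X_ne_zero).1 h'
  have hab : (X ^ 2 : K[X]) ∣ a - b := by
    have h : I.φA.hom ≫ xPow K 1 3 3 = xPow K 1 3 3 ≫ I.φB.hom := I.comm_f
    rw [hA, hB] at h
    exact congr_of_comm h
  have hbc : (X ^ 2 : K[X]) ∣ b - c := by
    have h : I.φB.hom ≫ xPow K 1 3 3 = xPow K 1 3 3 ≫ I.φC.hom := I.comm_g
    rw [hB, hC] at h
    exact congr_of_comm h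
  have hE := endomorphism_cone_components (φ := I.φE.hom) (a := 2) (b := 1) (s := c) (t := a)
    (by norm_num) rfl (by simpa using (dvd_add hab hbc).neg_right)
    (by rw [← hC]; exact I.comm_h') (by rw [← hA]; exact I.comm_h'')
  have hD := endomorphism_cone_components (φ := I.φD.hom) (a := 1) (b := 2) (s := b) (t := a)
    (by norm_num) rfl
    (by rw [dvd_sub_comm]; exact (pow_dvd_pow X one_le_two).trans hab)
    (by rw [← hB]; exact I.comm_f') (by
      -- The two morphisms `f''` are composites with different `k`; both equal `fromCone K 1 2`.
      have h₁ := mulXMatrix_comp_fromCone (K := K) 0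
      have h₂ := mulXMatrix_comp_fromCone (K := K) 1
      rw [yPoly_zero] at h₁
      rw [← yExt_eq_yPoly] at h₂
      have h := I.comm_f''
      dsimp only at h
      rw [← hA]
      exact (congrArg (I.φD.hom ≫ ·) h₂).symm.trans (h.trans (congrArg (· ≫ _) h₁)))
  obtain ⟨-, q, hq, hE⟩ := hE
  obtain ⟨hD₂, r, hr, hD₁⟩ := hD
  have hk : I.φD.hom ≫ mulXMatrix K (yExt K 1 2) = mulXMatrix K 0 ≫ I.φE.hom := I.comm_k
  have hb₀ : yPoly K b 1 2 = 0 := by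
    have h := (biprod.inr ≫= hk) =≫ biprod.fst
    have hl : (biprod.inr ≫ I.φD.hom ≫ mulXMatrix K (yExt K 1 2)) ≫ biprod.fst =
        (biprod.inr ≫ I.φD.hom ≫ biprod.fst) ≫ (xPow K 1 1 2)⟦(1 : ℤ)⟧' +
          (biprod.inr ≫ I.φD.hom ≫ biprod.snd) ≫ yExt K 1 2 := by
      simp [biprodMatrix, biprod.desc_eq]
    have hr' : (biprod.inr ≫ mulXMatrix K 0 ≫ I.φE.hom) ≫ biprod.fst =
        xPow K 1 1 2 ≫ biprod.inr ≫ I.φE.hom ≫ biprod.fst := by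
      have : biprod.inr ≫ mulXMatrix K 0 = xPow K 1 1 2 ≫ biprod.inr := by
        apply biprod.hom_ext <;> simp [biprodMatrix]
      rw [reassoc_of% this]
      simp
    -- Both corner terms now vanish: the one from `D` becomes `r x • y` on `R_1`, and the one from
    -- `E` passes through `R_1 ⟶ R_2 ⟶ R_1`, multiplication by `x q`.
    obtain ⟨r, rfl⟩ : X ∣ r := by
      rw [pow_succ', pow_one] at hr
      exact (mul_dvd_mul_iff_left X_ne_zero).1 hr
    rw [hl, hr', hD₁, hD₂, hE, yExt_eq_yPoly 2 1, mulPoly_comp_yPoly (s := r) _ (by ring),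
      yPoly_comp_xPow, yPoly_eq_zero_of_dvd_left _ (by simp), zero_add, ← Category.assoc,
      xPow_eq_mulPoly, mulPoly_comp, mulPoly_eq_zero (p := X ^ 1 * q) (by simp),
      Limits.zero_comp] at h
    exact h
  have h₁ : (X ^ 3 : K[X]) ∣ b * b' - 1 := by
    have h : I.φB.hom ≫ I.φB.inv = 𝟙 (truncObj K 3) := I.φB.hom_inv_id
    rw [hB, hB', mulPoly_comp, ← mulPoly_one] at h
    exact dvd_of_mulPoly_eq h
  have h₂ : X ∣ b := X_dvd_of_yPoly_eq_zero one_ne_zero two_ne_zero hb₀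
  have h₃ : (X : K[X]) ∣ 1 :=
    (dvd_sub_right (h₂.mul_right b')).1 ((dvd_pow_self X three_ne_zero).trans h₁)
  exact not_isUnit_X (isUnit_of_dvd_one h₃)

end NonIsomorphic

end

theorem proposition2p3 (K : Type u) [Field K] [HasDerivedCategory.{w} (FGModuleCat.{u} K[X])] :
    (octahedron₁ K).IsGoodOctahedron ∧ (octahedron₂ K).IsGoodOctahedron ∧
      IsEmpty (OctahedralDiagram.Iso (octahedron₁ K) (octahedron₂ K)) ∧
      (octahedron₁ K).f'' = (octahedron₂ K).f'' ∧ (octahedron₁ K).g' = (octahedron₂ K).g' ∧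
      (octahedron₁ K).l = (octahedron₂ K).l ∧ (octahedron₁ K).l' = (octahedron₂ K).l' := by
  have e₁ : yPoly K 1 1 2 = yExt K 1 2 := (yExt_eq_yPoly 1 2).symm
  have e₂ : yPoly K (-1) 2 1 = -yExt K 2 1 := by rw [yPoly_neg, yExt_eq_yPoly]
  refine ⟨?_, ?_, isEmpty_iso, ?_, ?_, ?_, ?_⟩
  · have h := octahedronWith_isGoodOctahedron (K := K) 0
    rw [yPoly_zero, yPoly_zero, neg_zero] at h
    exact h
  · have h := octahedronWith_isGoodOctahedron (K := K) 1
    rw [e₁, ← yExt_eq_yPoly] at h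
    exact h
  · have h := (mulXMatrix_comp_fromCone (K := K) 0).trans (mulXMatrix_comp_fromCone 1).symm
    rw [yPoly_zero, e₁] at h
    exact h
  · have h := (toCone_comp_reductionMatrix (K := K) 0).trans (toCone_comp_reductionMatrix (-1)).symm
    rw [yPoly_zero, e₂] at h
    exact h
  · have h := (toCone_comp_mulXMatrix (K := K) 0).trans (toCone_comp_mulXMatrix 1).symm
    rw [yPoly_zero, e₁] at h
    exact h
  · have h := (reductionMatrix_comp_fromCone (K := K) 0).trans
      (reductionMatrix_comp_fromCone (-1)).symm
    rw [yPoly_zero, e₂] at h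
    exact h
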